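/- Let $A\in\mathbb{R}^{n\times n}$ be symmetric with spectrum $\sigma(A)\subset[a,b]$, $0\le a<b$, and put $\gamma=a/b$. Let $S(A)=-\sum_{i=1}^n\lambda_i\log\lambda_i$, where $\lambda_1,\dots,\lambda_n$ are the eigenvalues of $A$ counted with multiplicity and $0\log 0=0$. Write $f(x)=-x\log x$ (with $f(0)=0$) and $f(A)=-A\log A=U\,\mathrm{diag}(f(\lambda_1),\dots,f(\lambda_n))\,U^T$, where $A=U\,\mathrm{diag}(\lambda_1,\dots,\lambda_n)\,U^T$ with $U$ orthogonal. Let $\mathcal G(A)$ be the graph on $\{1,\dots,n\}$ in which $i\ne j$ are adjacent if and only if $A_{ij}\neq 0$. Let $d\ge 2$ be an integer and let $V_1,\dots,V_s$ be the color classes of a distance-$d$ coloring of $\mathcal G(A)$, i.e. a partition of $\{1,\dots,n\}$ (classes may be empty) such that any two distinct nodes at geodesic distance at most $d$ in $\mathcal G(A)$ lie in different classes. Put $v_\ell=\sum_{i\in V_\ell}e_i$, with $e_i$ the canonical basis vectors, and $$\mathcal T_d(-A\log A)=\sum_{\ell=1}^s v_\ell^T f(A)\,v_\ell .$$ Then $$\bigl|S(A)-\mathcal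 T_d(-A\log A)\bigr|\le n\,b\,(1-\sqrt\gamma)\,\frac{1+\gamma+2d\sqrt\gamma}{2(d^2-1)}\left(\frac{1-\sqrt\gamma}{1+\sqrt\gamma}\right)^{d}.$$ In particular, if $a=0$, then $$\bigl|S(A)-\mathcal T_d(-A\log A)\bigr|\le \frac{nb}{2(d^2-1)} .$$ -/

import Mathlib

open scoped Matrix

/-- The graph associated with a symmetric matrix `A`: its nodes are the indices, and `i ≠ j` are
linked by an edge iff `A i j ≠ 0`. -/
def matrixGraph {n : ℕ} (A : Matrix (Fin n) (Fin n) ℝ) (hA : A.IsSymm) : SimpleGraph (Fin n) where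
  Adj i j := i ≠ j ∧ A i j ≠ 0
  symm := ⟨fun i j h => ⟨h.1.symm, by rw [hA.apply]; exact h.2⟩⟩
  loopless := ⟨fun _ h => h.1 rfl⟩

/-- A coloring `col` of the nodes of `G` is a distance-`d` coloring if two distinct nodes at
geodesic distance at most `d` have different colors (`edist` is `⊤` when there is no walk). -/
def IsDistanceColoring {V C : Type*} (G : SimpleGraph V) (d : ℕ) (col : V → C) : Prop :=
  ∀ i j : V, i ≠ j → G.edist i j ≤ (d : ℕ∞) → col i ≠ col j

/-- The probing vector of the color `l`: the sum of the canonical basis vectors `e i` over all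
nodes `i` of color `l`. -/
def probingVector {n s : ℕ} (col : Fin n → Fin s) (l : Fin s) : Fin n → ℝ :=
  ∑ i with col i = l, Pi.single i 1

/-- The approximation `∑ l, v_lᵀ B v_l` of the trace of `B` induced by a coloring. -/
def probingTrace {n s : ℕ} (col : Fin n → Fin s) (B : Matrix (Fin n) (Fin n) ℝ) : ℝ :=
  ∑ l : Fin s, probingVector col l ⬝ᵥ (B *ᵥ probingVector col l)

theorem isHermitian_of_isSymm {n : ℕ} {A : Matrix (Fin n) (Fin n) ℝ} (hA : A.IsSymm) :
    A.IsHermitian := by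
  rw [Matrix.IsHermitian, Matrix.conjTranspose_eq_transpose_of_trivial]
  exact hA

/-- The von Neumann entropy `S(A) = - ∑ λ_i log λ_i`, over the eigenvalues of the symmetric matrix
`A` counted with multiplicity, with the convention `0 log 0 = 0`. -/
noncomputable def vonNeumannEntropy {n : ℕ} (A : Matrix (Fin n) (Fin n) ℝ) (hA : A.IsSymm) : ℝ :=
  - ∑ i : Fin n, (isHermitian_of_isSymm hA).eigenvalues i *
      Real.log ((isHermitian_of_isSymm hA).eigenvalues i)

/-- The matrix function `f(A) = U diag(f(λ_1), …, f(λ_n)) Uᵀ` of a symmetric matrix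
`A = U diag(λ_1, …, λ_n) Uᵀ`, for a spectral decomposition of `A` with `U` orthogonal. -/
noncomputable def matrixFunction {n : ℕ} (f : ℝ → ℝ) (A : Matrix (Fin n) (Fin n) ℝ)
    (hA : A.IsSymm) : Matrix (Fin n) (Fin n) ℝ :=
  let hH := isHermitian_of_isSymm hA
  let U : Matrix (Fin n) (Fin n) ℝ := hH.eigenvectorUnitary
  U * Matrix.diagonal (fun i => f (hH.eigenvalues i)) * Uᵀ

/-! With `t i` the sum over the colors of the squared components of the probing vectors along the
`i`-th eigenvector, the error is `∑ (t i - 1) * λ i * log (λ i)`. This functional kills polynomials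
of degree at most `d`: `p(A)` has no entries between distinct nodes of one color, so probing gives
its exact trace. Since `t i ≥ 0` and `∑ t i = n`, its mass is at most `2 n`. It remains to bound
such a functional on `x log x` (`abs_sum_mul_mul_log_le`). After rescaling `[a, b]` to `[-1, 1]`, `x
log x` is, up to a linear term and a factor, `(y + z) log (1 + 2 w₀ y + w₀²)`. Its derivative in the
parameter `w`, with `z` fixed, is linear in `y` plus a multiple of `1 / (1 + 2 w y + w²)`, whose
polynomial approximation is explicit; integrating in `w` gives the bound. -/

/-! ### Polynomial approximation of the rational kernel. -/

open Polynomial in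
/-- The numerator of the error of the best uniform approximation on `[-1, 1]` of
`y ↦ (1 - 2 w y + w²)⁻¹` by a polynomial of degree at most `d` (Chebyshev, Bernstein). -/
theorem exists_polynomial_one_sub_mul_eq_chebyshev {w : ℝ} (hw : 1 - w ^ 2 ≠ 0) (d : ℕ) :
    ∃ P : ℝ[X], P.natDegree ≤ d ∧ ∀ y : ℝ, 1 - (1 - 2 * w * y + w ^ 2) * P.eval y =
      2 * w ^ (d + 1) / (1 - w ^ 2) ^ 2 *
        ((Chebyshev.T ℝ (d + 1)).eval y - 2 * w * (Chebyshev.T ℝ d).eval y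
          + w ^ 2 * (Chebyshev.T ℝ (d - 1)).eval y) := by
  induction d with
  | zero =>
    refine ⟨C ((1 + w ^ 2) / (1 - w ^ 2) ^ 2), by simp, fun y => ?_⟩
    have h1 : Chebyshev.T ℝ (-1) = X := by
      rw [Chebyshev.T_neg, Chebyshev.T_one]
    simp only [Nat.cast_zero, zero_add, zero_sub, h1, Chebyshev.T_one, Chebyshev.T_zero, eval_C,
      eval_X, eval_one]
    field_simp
    ring
  | succ d ih =>
    obtain ⟨P, hP, h⟩ := ih
    -- With `q = 1 - 2wy + w²` and `E d` the Chebyshev combination, `E d - q (T (d+1) - w T d) = w E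
    -- (d+1)`; this dictates the increment.
    refine ⟨P + C (2 * w ^ (d + 1) / (1 - w ^ 2) ^ 2) *
      (Chebyshev.T ℝ (d + 1) - C w * Chebyshev.T ℝ d), ?_, fun y => ?_⟩
    · have hT (k : ℕ) (hk : k ≤ d + 1) : (Chebyshev.T ℝ k).natDegree ≤ d + 1 := by
        rw [Chebyshev.natDegree_T]; simpa using hk
      refine natDegree_add_le_of_degree_le (hP.trans d.le_succ) ?_
      refine (natDegree_C_mul_le _ _).trans ((natDegree_sub_le _ _).trans (max_le ?_ ?_))
      · exact_mod_cast hT (d + 1) le_rfl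
      · exact (natDegree_C_mul_le _ _).trans (hT d d.le_succ)
    · have e2 := congrArg (eval y) (Chebyshev.T_add_two ℝ (d : ℤ))
      have e1 := congrArg (eval y) (Chebyshev.T_add_two ℝ ((d : ℤ) - 1))
      rw [show (d : ℤ) - 1 + 2 = d + 1 by ring, show (d : ℤ) - 1 + 1 = d by ring] at e1
      have h' := h y
      simp only [eval_sub, eval_mul, eval_X, eval_ofNat, eval_add, eval_C] at e1 e2 ⊢
      push_cast
      rw [show (d : ℤ) + 1 + 1 = d + 2 by ring, show (d : ℤ) + 1 - 1 = d by ring, e2]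
      generalize eval y (Chebyshev.T ℝ (d - 1)) = A at *
      generalize eval y (Chebyshev.T ℝ (d + 1)) = B at *
      generalize eval y (Chebyshev.T ℝ d) = D at *
      have hA : A = 2 * y * D - B := by linarith
      subst hA
      rw [pow_succ w (d + 1)]
      linear_combination h'

/-- With `y = cos θ` and `u = exp (i θ)`, the left-hand side is
`|Re (u ^ (d - 1) * (u - w) ^ 2)|`, and the right-hand side is `|u - w| ^ 2`. -/
theorem abs_chebyshev_combination_le (w : ℝ) (d : ℕ) {y : ℝ} (hy : |y| ≤ 1) :
    |(Polynomial.Chebyshev.T ℝ (d + 1)).eval y - 2 * w * (Polynomial.Chebyshev.T ℝ d).eval y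
      + w ^ 2 * (Polynomial.Chebyshev.T ℝ (d - 1)).eval y| ≤ 1 - 2 * w * y + w ^ 2 := by
  obtain ⟨h1, h2⟩ := abs_le.mp hy
  obtain ⟨θ, rfl⟩ : ∃ θ, Real.cos θ = y := ⟨_, Real.cos_arccos h1 h2⟩
  rw [Polynomial.Chebyshev.T_real_cos, Polynomial.Chebyshev.T_real_cos,
    Polynomial.Chebyshev.T_real_cos]
  push_cast
  rw [add_mul, sub_mul, one_mul, Real.cos_add, Real.cos_sub]
  have hs := Real.sin_sq_add_cos_sq θ
  have hS := Real.sin_sq_add_cos_sq (d * θ)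
  generalize Real.cos (d * θ) = C at *
  generalize Real.sin (d * θ) = S at *
  generalize Real.cos θ = c at *
  generalize Real.sin θ = s at *
  have hq : 0 ≤ 1 - 2 * w * c + w ^ 2 := by nlinarith [sq_nonneg (1 - w * c), sq_nonneg (w * s)]
  refine abs_le_of_sq_le_sq ?_ hq
  -- The squared terms are the real and imaginary parts of `u⁻¹ (u - w)²`; `key2` multiplies by `u ^
  -- d`, of modulus 1.
  have key : (1 - 2 * w * c + w ^ 2) ^ 2
      = (c * (1 + w ^ 2) - 2 * w) ^ 2 + (s * (1 - w ^ 2)) ^ 2 := by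
    linear_combination (-(1 - w ^ 2) ^ 2) * hs
  have key2 : (1 - 2 * w * c + w ^ 2) ^ 2
      = (C * c - S * s - 2 * w * C + w ^ 2 * (C * c + S * s)) ^ 2
        + (S * (c * (1 + w ^ 2) - 2 * w) + C * (s * (1 - w ^ 2))) ^ 2 := by
    linear_combination key - ((c * (1 + w ^ 2) - 2 * w) ^ 2 + (s * (1 - w ^ 2)) ^ 2) * hS
  rw [key2]
  exact le_add_of_nonneg_right (sq_nonneg _)

/-- Bernstein's bound for the polynomial approximation of `y ↦ (1 - 2 w y + w²)⁻¹` on `[-1, 1]`. -/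
theorem exists_polynomial_abs_inv_sub_le {w : ℝ} (hw : |w| < 1) (d : ℕ) :
    ∃ P : Polynomial ℝ, P.natDegree ≤ d ∧ ∀ y : ℝ, |y| ≤ 1 →
      |(1 - 2 * w * y + w ^ 2)⁻¹ - P.eval y| ≤ 2 * |w| ^ (d + 1) / (1 - w ^ 2) ^ 2 := by
  have hw2 : 0 < 1 - w ^ 2 := by
    have := (sq_lt_one_iff_abs_lt_one w).mpr hw
    linarith
  obtain ⟨P, hP, h⟩ := exists_polynomial_one_sub_mul_eq_chebyshev hw2.ne' d
  refine ⟨P, hP, fun y hy => ?_⟩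
  have hq : 0 < 1 - 2 * w * y + w ^ 2 := by
    have : w * y ≤ |w| := (le_abs_self _).trans (by
      rw [abs_mul]; exact mul_le_of_le_one_right (abs_nonneg _) hy)
    nlinarith [sq_abs w, sq_pos_of_pos (sub_pos.mpr hw)]
  have hB := abs_chebyshev_combination_le w d hy
  have hN := h y
  generalize 1 - 2 * w * y + w ^ 2 = q at *
  have : q⁻¹ - P.eval y = (1 - q * P.eval y) / q := by field_simp
  rw [this, hN, abs_div, abs_of_pos hq, div_le_iff₀ hq, abs_mul, abs_div, abs_mul, abs_pow,
    abs_of_pos (pow_pos hw2 2), abs_two]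
  exact mul_le_mul_of_nonneg_left hB (by positivity)

/-! ### Functionals vanishing on polynomials, applied to the logarithm. -/

/-- A functional with finite support in `[-1, 1]` that vanishes on the polynomials of degree at most
`d` is small on the `w`-derivative of `(y + z₀) log (1 + 2 w y + w²)`. -/
theorem abs_sum_mul_div_le {ι : Type*} [Fintype ι] {c y : ι → ℝ} {d : ℕ} (hd : 1 ≤ d)
    (hy : ∀ i, |y i| ≤ 1)
    (hc : ∀ p : Polynomial ℝ, p.natDegree ≤ d → ∑ i, c i * p.eval (y i) = 0)
    {w w₀ : ℝ} (hw : 0 < w) (hw1 : w < w₀) (hw₀ : w₀ ≤ 1) :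
    |∑ i, c i * ((y i + (1 + w₀ ^ 2) / (2 * w₀)) * ((2 * y i + 2 * w) / (1 + 2 * w * y i + w ^ 2)))|
      ≤ (∑ i, |c i|) * ((w₀ - w) * (1 - w * w₀) * w ^ (d - 1) / (w₀ * (1 - w ^ 2))) := by
  have hw₀' : 0 < w₀ := hw.trans hw1
  have hlt : w < 1 := hw1.trans_le hw₀
  have hw2 : 0 < 1 - w ^ 2 := by nlinarith
  have habs : |-w| < 1 := by rw [abs_neg, abs_of_pos hw]; exact hlt
  obtain ⟨P, hP, hb⟩ := exists_polynomial_abs_inv_sub_le habs d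
  set z₀ := (1 + w₀ ^ 2) / (2 * w₀) with hz
  -- Value of `(y + z₀)(2y + 2w)` at the root of `1 + 2wy + w²`, i.e. the remainder of the division
  -- in `y`; `hlin` kills the linear quotient.
  set κ := (1 - w ^ 2) * ((w₀ - w) * (1 - w * w₀) / (2 * w * w₀)) / w with hκ
  have hww : 0 < 1 - w * w₀ := by nlinarith
  have hκ0 : 0 ≤ κ := by
    have : 0 < w₀ - w := sub_pos.mpr hw1
    positivity
  have hlin : ∑ i, c i * (w⁻¹ * y i + (z₀ / w - (1 - w ^ 2) / (2 * w ^ 2))) = 0 := by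
    have := hc (Polynomial.C w⁻¹ * Polynomial.X + Polynomial.C (z₀ / w - (1 - w ^ 2) / (2 * w ^ 2)))
      (Polynomial.natDegree_linear_le.trans hd)
    simpa using this
  have hsum : ∑ i, c i * ((y i + z₀) * ((2 * y i + 2 * w) / (1 + 2 * w * y i + w ^ 2)))
      = κ * ∑ i, c i * ((1 - 2 * (-w) * y i + (-w) ^ 2)⁻¹ - P.eval (y i)) := by
    simp_rw [mul_sub, Finset.sum_sub_distrib]
    rw [hc P hP, sub_zero, Finset.mul_sum, ← sub_eq_zero, ← hlin, ← Finset.sum_sub_distrib]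
    refine Finset.sum_congr rfl fun i _ => ?_
    have hq : 0 < 1 + 2 * w * y i + w ^ 2 := by
      nlinarith [(abs_le.mp (hy i)).1, sq_pos_of_pos (sub_pos.mpr hlt)]
    rw [show 1 - 2 * (-w) * y i + (-w) ^ 2 = 1 + 2 * w * y i + w ^ 2 by ring, hκ, hz]
    obtain ⟨q, hq'⟩ : ∃ q, q = 1 + 2 * w * y i + w ^ 2 := ⟨_, rfl⟩
    have hyq : y i = (q - 1 - w ^ 2) / (2 * w) := by rw [hq']; field_simp; ring
    rw [← hq'] at hq ⊢
    rw [hyq]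
    field_simp
    ring
  rw [hsum, abs_mul, abs_of_nonneg hκ0]
  have hS : |∑ i, c i * ((1 - 2 * (-w) * y i + (-w) ^ 2)⁻¹ - P.eval (y i))|
      ≤ (∑ i, |c i|) * (2 * w ^ (d + 1) / (1 - w ^ 2) ^ 2) := by
    rw [Finset.sum_mul]
    refine (Finset.abs_sum_le_sum_abs _ _).trans (Finset.sum_le_sum fun i _ => ?_)
    rw [abs_mul]
    have := hb (y i) (hy i)
    rw [abs_neg, abs_of_pos hw, neg_sq w] at this
    rw [neg_sq w]
    exact mul_le_mul_of_nonneg_left this (abs_nonneg _)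
  refine (mul_le_mul_of_nonneg_left hS hκ0).trans (le_of_eq ?_)
  obtain ⟨k, rfl⟩ : ∃ k, d = k + 1 := ⟨d - 1, by omega⟩
  rw [hκ, Nat.add_sub_cancel]
  field_simp
  ring

/-- The bound of `abs_sum_mul_div_le`, integrated over `w ∈ [0, w₀]`. -/
theorem abs_sum_mul_log_le {ι : Type*} [Fintype ι] {c y : ι → ℝ} {d : ℕ} (hd : 2 ≤ d)
    (hy : ∀ i, |y i| ≤ 1)
    (hc : ∀ p : Polynomial ℝ, p.natDegree ≤ d → ∑ i, c i * p.eval (y i) = 0)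
    {w₀ : ℝ} (hw₀ : 0 < w₀) (hw₁ : w₀ ≤ 1) :
    |∑ i, c i * ((y i + (1 + w₀ ^ 2) / (2 * w₀)) * Real.log (1 + 2 * w₀ * y i + w₀ ^ 2))|
      ≤ (∑ i, |c i|) * (w₀ / (2 * (1 + w₀)) *
          (w₀ ^ (d - 1) / ((d : ℝ) - 1) - w₀ ^ (d + 1) / (d + 1))) := by
  have hd1 : (d : ℝ) - 1 ≠ 0 := by
    have : (2 : ℝ) ≤ d := by exact_mod_cast hd
    linarith
  have hd2 : (d : ℝ) + 1 ≠ 0 := by positivity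
  set z₀ := (1 + w₀ ^ 2) / (2 * w₀) with hz
  set S := ∑ i, |c i| with hS
  have hS0 : 0 ≤ S := Finset.sum_nonneg fun i _ => abs_nonneg _
  have hpos (i) {w : ℝ} (h0 : 0 ≤ w) (h1 : w < 1) : 0 < 1 + 2 * w * y i + w ^ 2 := by
    nlinarith [(abs_le.mp (hy i)).1, sq_pos_of_pos (sub_pos.mpr h1)]
  have hder (i) {w : ℝ} (h0 : 0 ≤ w) (h1 : w < 1) : HasDerivAt
      (fun w => c i * ((y i + z₀) * Real.log (1 + 2 * w * y i + w ^ 2)))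
      (c i * ((y i + z₀) * ((2 * y i + 2 * w) / (1 + 2 * w * y i + w ^ 2)))) w := by
    have h : HasDerivAt (fun w : ℝ => 1 + 2 * w * y i + w ^ 2) (2 * y i + 2 * w) w := by
      exact (((((hasDerivAt_id w).const_mul 2).mul_const (y i)).const_add 1).add
        ((hasDerivAt_id w).pow 2)).congr_deriv (by simp)
    exact ((h.log (hpos i h0 h1).ne').const_mul _).const_mul _
  have := image_norm_le_of_norm_deriv_right_le_deriv_boundary
    (f := fun w => ∑ i, c i * ((y i + z₀) * Real.log (1 + 2 * w * y i + w ^ 2)))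
    (f' := fun w => ∑ i, c i * ((y i + z₀) * ((2 * y i + 2 * w) / (1 + 2 * w * y i + w ^ 2))))
    (a := 0) (b := w₀)
    (B := fun w => S * (w₀ / (2 * (1 + w₀)) *
      (w ^ (d - 1) / ((d : ℝ) - 1) - w ^ (d + 1) / (d + 1))))
    (B' := fun w => S * (w₀ / (2 * (1 + w₀)) * (w ^ (d - 2) - w ^ d)))
    ?_ ?_ ?_ ?_ ?_ (Set.right_mem_Icc.mpr hw₀.le)
  · simpa using this
  · refine continuousOn_finsetSum _ fun i _ => ?_
    -- The logarithm is singular only at `w = w₀ = 1`, `y i = -1`, where its prefactor vanishes.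
    by_cases hyz : y i + z₀ = 0
    · simpa [hyz] using continuousOn_const
    refine continuousOn_const.mul (continuousOn_const.mul (ContinuousOn.log (by fun_prop) ?_))
    intro w hw
    rcases (hw.2.trans hw₁).lt_or_eq with h | h
    · exact (hpos i hw.1 h).ne'
    · have h1 : w₀ = 1 := le_antisymm hw₁ (h ▸ hw.2)
      rw [hz, h1] at hyz
      rw [h]
      intro h2
      apply hyz
      linarith
  · intro w hw
    exact (HasDerivAt.fun_sum fun i _ => hder i hw.1 (hw.2.trans_le hw₁)).hasDerivWithinAt
  · have h1 : d - 1 ≠ 0 := by omega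
    simp [h1]
  · intro w
    have h1 := (((hasDerivAt_pow (d - 1) w).div_const ((d : ℝ) - 1)).sub
      ((hasDerivAt_pow (d + 1) w).div_const ((d : ℝ) + 1))).const_mul (w₀ / (2 * (1 + w₀)))
        |>.const_mul S
    refine h1.congr_deriv ?_
    have e : ((d - 1 : ℕ) : ℝ) = (d : ℝ) - 1 := by
      rw [Nat.cast_sub (by omega)]; simp
    rw [e, Nat.sub_sub, Nat.add_sub_cancel]
    push_cast
    field_simp
  · intro w hw
    rw [Real.norm_eq_abs]
    rcases hw.1.eq_or_lt with h | h
    · subst h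
      -- At `w = 0`, where the partial fractions degenerate, the derivative is quadratic in `y`,
      -- hence killed as `d ≥ 2`.
      have h1 := hc (2 * Polynomial.X ^ 2 + Polynomial.C (2 * z₀) * Polynomial.X)
        (le_trans (by compute_degree) hd)
      have h2 : ∑ i, c i * ((y i + z₀) * ((2 * y i + 2 * 0) / (1 + 2 * 0 * y i + 0 ^ 2))) = 0 := by
        refine (Finset.sum_congr rfl fun i _ => ?_).trans h1
        simp only [Polynomial.eval_add, Polynomial.eval_mul, Polynomial.eval_pow, Polynomial.eval_X,
          Polynomial.eval_C, Polynomial.eval_ofNat]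
        ring
      rw [h2, abs_zero, zero_pow (by omega : d ≠ 0), sub_zero]
      positivity
    · have hlt : w < 1 := hw.2.trans_le hw₁
      refine (abs_sum_mul_div_le (by omega) hy hc h hw.2 hw₁).trans
        (mul_le_mul_of_nonneg_left ?_ hS0)
      have hw2 : 0 < 1 - w ^ 2 := by nlinarith
      obtain ⟨k, rfl⟩ : ∃ k, d = k + 2 := ⟨d - 2, by omega⟩
      rw [Nat.add_sub_cancel, show k + 2 - 1 = k + 1 by omega, div_mul_eq_mul_div,
        div_le_div_iff₀ (by positivity) (by positivity)]
      have hP : 0 ≤ w₀ - w := (sub_pos.mpr hw.2).le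
      have hQ : 0 ≤ 1 - w * w₀ := by nlinarith
      -- AM-GM for `w₀ - w` and `w (1 - w w₀)`, whose sum is `w₀ (1 - w²)`, together with `2 (1 +
      -- w₀) ≤ 4`.
      have key : 2 * (1 + w₀) * (w * ((w₀ - w) * (1 - w * w₀))) ≤ w₀ ^ 2 * (1 - w ^ 2) ^ 2 := by
        have e1 : 0 ≤ w * ((w₀ - w) * (1 - w * w₀)) := by positivity
        nlinarith [sq_nonneg ((w₀ - w) - w * (1 - w * w₀))]
      have := mul_le_mul_of_nonneg_left key (pow_nonneg h.le k)
      calc _ = w ^ k * (2 * (1 + w₀) * (w * ((w₀ - w) * (1 - w * w₀)))) := by ring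
        _ ≤ _ := this
        _ = _ := by ring

/-- A functional with finite support in `[a, b]` that vanishes on the polynomials of degree at most
`d` is small on `x log x`. -/
theorem abs_sum_mul_mul_log_le {ι : Type*} [Fintype ι] {c x : ι → ℝ} {d : ℕ} (hd : 2 ≤ d)
    {a b : ℝ} (ha : 0 ≤ a) (hab : a < b) (hx : ∀ i, x i ∈ Set.Icc a b)
    (hc : ∀ p : Polynomial ℝ, p.natDegree ≤ d → ∑ i, c i * p.eval (x i) = 0) :
    |∑ i, c i * (x i * Real.log (x i))| ≤ (∑ i, |c i|) *
      (b * (1 - √(a / b)) * ((1 + a / b + 2 * d * √(a / b)) / (4 * ((d : ℝ) ^ 2 - 1)))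
        * ((1 - √(a / b)) / (1 + √(a / b))) ^ d) := by
  have hb : 0 < b := ha.trans_lt hab
  have hd' : (2 : ℝ) ≤ d := by exact_mod_cast hd
  have hd1 : (d : ℝ) - 1 ≠ 0 := by linarith
  have hd2 : (d : ℝ) + 1 ≠ 0 := by positivity
  have hd3 : (d : ℝ) ^ 2 - 1 ≠ 0 := by nlinarith
  obtain ⟨g, hg⟩ : ∃ g, g = √(a / b) := ⟨_, rfl⟩
  have hg0 : 0 ≤ g := hg ▸ Real.sqrt_nonneg _
  have hg2 : a / b = g ^ 2 := by rw [hg, Real.sq_sqrt (by positivity)]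
  have hag : a = b * g ^ 2 := by rw [← hg2]; field_simp
  have hg1 : g < 1 := by
    have : a / b < 1 := (div_lt_one hb).mpr hab
    nlinarith
  rw [← hg, hg2]
  subst hag
  -- Chosen so that the zero `-z` of `1 + 2wy + w²` corresponds to `x = 0`.
  obtain ⟨w, hw⟩ : ∃ w, w = (1 - g) / (1 + g) := ⟨_, rfl⟩
  have hw0 : 0 < w := by rw [hw]; exact div_pos (sub_pos.mpr hg1) (by positivity)
  have hw1 : w ≤ 1 := by rw [hw]; exact (div_le_one (by positivity)).mpr (by linarith)
  have hgw : g = (1 - w) / (1 + w) := by rw [hw]; field_simp; ring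
  obtain ⟨h, hh⟩ : ∃ h, h = b * (1 - g ^ 2) / 2 := ⟨_, rfl⟩
  have hh0 : 0 < h := by
    have : 0 < 1 - g ^ 2 := by nlinarith
    rw [hh]
    positivity
  have hbw : b = h * (1 + w) ^ 2 / (2 * w) := by rw [hh, hgw]; field_simp; ring
  set z := (1 + w ^ 2) / (2 * w) with hz
  have e1 : b = h * (z + 1) := by rw [hbw, hz]; field_simp; ring
  have e2 : b * g ^ 2 = h * (z - 1) := by rw [hgw, hbw, hz]; field_simp; ring
  set y : ι → ℝ := fun i => x i / h - z with hyd
  have hxy (i) : x i = h * (y i + z) := by simp only [hyd]; field_simp; ring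
  have hy (i) : |y i| ≤ 1 := by
    have h1 := (hx i).1
    have h2 := (hx i).2
    rw [hxy i, e2] at h1
    rw [hxy i, e1] at h2
    have h1 := le_of_mul_le_mul_left h1 hh0
    have h2 := le_of_mul_le_mul_left h2 hh0
    exact abs_le.mpr ⟨by linarith, by linarith⟩
  have hcy (p : Polynomial ℝ) (hp : p.natDegree ≤ d) : ∑ i, c i * p.eval (y i) = 0 := by
    have := hc (p.comp (Polynomial.C h⁻¹ * Polynomial.X + Polynomial.C (-z)))
      (Polynomial.natDegree_comp_le.trans
        ((Nat.mul_le_mul hp Polynomial.natDegree_linear_le).trans (by simp)))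
    rw [← this]
    refine Finset.sum_congr rfl fun i _ => ?_
    simp [hyd, div_eq_inv_mul, sub_eq_add_neg]
  have hS := abs_sum_mul_log_le hd hy hcy hw0 hw1
  have hlin : ∑ i, c i * (Real.log (h / (2 * w)) * x i) = 0 := by
    simpa using hc (Polynomial.C (Real.log (h / (2 * w))) * Polynomial.X)
      (((Polynomial.natDegree_C_mul_le _ _).trans Polynomial.natDegree_X_le).trans (by omega))
  have hsum : ∑ i, c i * (x i * Real.log (x i))
      = h * ∑ i, c i * ((y i + z) * Real.log (1 + 2 * w * y i + w ^ 2)) := by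
    rw [← sub_zero (∑ i, c i * (x i * Real.log (x i))), ← hlin, ← Finset.sum_sub_distrib,
      Finset.mul_sum]
    refine Finset.sum_congr rfl fun i _ => ?_
    have e : 1 + 2 * w * y i + w ^ 2 = 2 * w * (y i + z) := by rw [hz]; field_simp; ring
    by_cases hyz : y i + z = 0
    · simp [hxy i, hyz]
    · rw [e, hxy i, show h * (y i + z) = (h / (2 * w)) * (2 * w * (y i + z)) by field_simp,
        Real.log_mul (div_pos hh0 (by positivity)).ne' (mul_ne_zero (by positivity) hyz)]
      field_simp
      ring
  rw [hsum, abs_mul, abs_of_pos hh0]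
  refine (mul_le_mul_of_nonneg_left hS hh0.le).trans (le_of_eq ?_)
  rw [← hw, hgw, hbw]
  obtain ⟨k, rfl⟩ : ∃ k, d = k + 1 := ⟨d - 1, by omega⟩
  rw [Nat.add_sub_cancel]
  have hfac : ((k + 1 : ℕ) : ℝ) ^ 2 - 1 = (((k + 1 : ℕ) : ℝ) - 1) * (((k + 1 : ℕ) : ℝ) + 1) := by
    ring
  rw [hfac]
  generalize ((k + 1 : ℕ) : ℝ) = D at *
  field_simp
  ring

/-! ### Probing, sparsity of polynomials in `A`, and spectral weights. -/

theorem probingTrace_eq_sum {n s : ℕ} (col : Fin n → Fin s) (B : Matrix (Fin n) (Fin n) ℝ) :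
    probingTrace col B = ∑ i, ∑ j, if col i = col j then B i j else 0 := by
  have hv (l : Fin s) (i : Fin n) : probingVector col l i = if col i = l then 1 else 0 := by
    simp [probingVector, Finset.sum_apply, Pi.single_apply, Finset.sum_ite_eq, Finset.mem_filter]
  simp only [probingTrace, dotProduct, Matrix.mulVec, hv]
  rw [Finset.sum_comm]
  refine Finset.sum_congr rfl fun i _ => ?_
  simp [ite_mul, mul_ite, eq_comm]

theorem probingTrace_eq_trace {n s : ℕ} {col : Fin n → Fin s} {B : Matrix (Fin n) (Fin n) ℝ}
    (hB : ∀ i j, i ≠ j → col i = col j → B i j = 0) : probingTrace col B = B.trace := by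
  rw [probingTrace_eq_sum, Matrix.trace]
  refine Finset.sum_congr rfl fun i _ => ?_
  rw [Finset.sum_eq_single i (fun j _ hj => ?_) (by simp)]
  · simp
  · split_ifs with h
    · exact hB i j hj.symm h
    · rfl

/-- A nonzero entry of `A ^ k` needs a chain of `k` nonzero entries of `A`; diagonal ones do not
move, so the distance may be smaller than `k`. -/
theorem edist_le_of_pow_apply_ne_zero {n : ℕ} {A : Matrix (Fin n) (Fin n) ℝ} (hA : A.IsSymm)
    (k : ℕ) {i j : Fin n} (h : (A ^ k) i j ≠ 0) : (matrixGraph A hA).edist i j ≤ k := by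
  induction k generalizing j with
  | zero =>
    rw [pow_zero] at h
    have : i = j := by
      by_contra hij
      exact h (Matrix.one_apply_ne hij)
    simp [this]
  | succ k ih =>
    rw [pow_succ, Matrix.mul_apply] at h
    obtain ⟨l, -, hl⟩ := Finset.exists_ne_zero_of_sum_ne_zero h
    have h1 := ih (left_ne_zero_of_mul hl)
    have h2 : (matrixGraph A hA).edist l j ≤ 1 := by
      by_cases hlj : l = j
      · simp [hlj]
      · exact (SimpleGraph.edist_eq_one_iff_adj.mpr
          (show (matrixGraph A hA).Adj l j from ⟨hlj, right_ne_zero_of_mul hl⟩)).le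
    push_cast
    exact (SimpleGraph.edist_triangle).trans (add_le_add h1 h2)

theorem aeval_apply_eq_zero_of_lt_edist {n : ℕ} {A : Matrix (Fin n) (Fin n) ℝ} (hA : A.IsSymm)
    {d : ℕ} {p : Polynomial ℝ} (hp : p.natDegree ≤ d) {i j : Fin n}
    (h : (d : ℕ∞) < (matrixGraph A hA).edist i j) : Polynomial.aeval A p i j = 0 := by
  rw [Polynomial.aeval_eq_sum_range, Matrix.sum_apply]
  refine Finset.sum_eq_zero fun k hk => ?_
  rw [Matrix.smul_apply]
  by_contra hne
  have h1 := edist_le_of_pow_apply_ne_zero hA k (right_ne_zero_of_smul hne)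
  have h2 : k ≤ d := by
    have := Finset.mem_range.mp hk
    omega
  exact absurd (h1.trans (by exact_mod_cast h2)) (not_le.mpr h)

theorem matrixFunction_polynomial {n : ℕ} {A : Matrix (Fin n) (Fin n) ℝ} (hA : A.IsSymm)
    (p : Polynomial ℝ) : matrixFunction (fun x => p.eval x) A hA = Polynomial.aeval A p := by
  have hH := isHermitian_of_isSymm hA
  set U : Matrix (Fin n) (Fin n) ℝ := ↑hH.eigenvectorUnitary with hU
  have hUU : Uᵀ * U = 1 := by
    have := Unitary.coe_star_mul_self hH.eigenvectorUnitary
    rwa [Matrix.star_eq_conjTranspose, Matrix.conjTranspose_eq_transpose_of_trivial] at this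
  have hUU' : U * Uᵀ = 1 := mul_eq_one_comm.mp hUU
  have hAU : A = U * Matrix.diagonal hH.eigenvalues * Uᵀ := by
    have := hH.spectral_theorem
    rw [Unitary.conjStarAlgAut_apply, Matrix.star_eq_conjTranspose,
      Matrix.conjTranspose_eq_transpose_of_trivial] at this
    exact this
  have hpow (k : ℕ) : A ^ k = U * Matrix.diagonal (fun i => hH.eigenvalues i ^ k) * Uᵀ := by
    induction k with
    | zero => simp [hUU']
    | succ k ih =>
      rw [pow_succ, ih]
      nth_rewrite 2 [hAU]
      calc _ = U * Matrix.diagonal (fun i => hH.eigenvalues i ^ k) * (Uᵀ * U)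
              * Matrix.diagonal hH.eigenvalues * Uᵀ := by simp only [Matrix.mul_assoc]
        _ = _ := by
          rw [hUU, Matrix.mul_one, Matrix.mul_assoc U, Matrix.diagonal_mul_diagonal]
          simp only [pow_succ]
  change U * Matrix.diagonal (fun i => p.eval (hH.eigenvalues i)) * Uᵀ = _
  induction p using Polynomial.induction_on' with
  | add p q hp hq =>
    rw [map_add, ← hp, ← hq, ← Matrix.add_mul, ← Matrix.mul_add, Matrix.diagonal_add]
    simp
  | monomial k r =>
    rw [Polynomial.aeval_monomial, hpow, ← Algebra.smul_def, ← Matrix.smul_mul, ← Matrix.mul_smul,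
      ← Matrix.diagonal_smul]
    simp [Pi.smul_def]

theorem trace_matrixFunction {n : ℕ} {A : Matrix (Fin n) (Fin n) ℝ} (hA : A.IsSymm)
    (f : ℝ → ℝ) : (matrixFunction f A hA).trace
      = ∑ i, f ((isHermitian_of_isSymm hA).eigenvalues i) := by
  have hH := isHermitian_of_isSymm hA
  have := Unitary.coe_star_mul_self hH.eigenvectorUnitary
  rw [Matrix.star_eq_conjTranspose, Matrix.conjTranspose_eq_transpose_of_trivial] at this
  rw [matrixFunction, Matrix.trace_mul_comm, ← Matrix.mul_assoc, this, Matrix.one_mul,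
    Matrix.trace_diagonal]

/-- The probing approximation of `tr f(A)` is a nonnegative combination of the values `f(λ i)`. -/
theorem exists_probingTrace_matrixFunction_eq_sum {n s : ℕ} (col : Fin n → Fin s)
    {A : Matrix (Fin n) (Fin n) ℝ} (hA : A.IsSymm) :
    ∃ t : Fin n → ℝ, (∀ i, 0 ≤ t i) ∧ ∀ f : ℝ → ℝ, probingTrace col (matrixFunction f A hA)
      = ∑ i, t i * f ((isHermitian_of_isSymm hA).eigenvalues i) := by
  have hH := isHermitian_of_isSymm hA
  set U : Matrix (Fin n) (Fin n) ℝ := ↑hH.eigenvectorUnitary with hU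
  refine ⟨fun i => ∑ l, (Uᵀ *ᵥ probingVector col l) i ^ 2,
    fun i => Finset.sum_nonneg fun l _ => sq_nonneg _, fun f => ?_⟩
  simp only [Finset.sum_mul]
  rw [Finset.sum_comm]
  refine Finset.sum_congr rfl fun l _ => ?_
  change _ ⬝ᵥ ((U * Matrix.diagonal (fun i => f (hH.eigenvalues i)) * Uᵀ) *ᵥ _) = _
  rw [← Matrix.mulVec_mulVec, ← Matrix.mulVec_mulVec, Matrix.dotProduct_mulVec,
    ← Matrix.mulVec_transpose, dotProduct]
  refine Finset.sum_congr rfl fun i _ => ?_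
  rw [Matrix.mulVec_diagonal]
  ring

theorem mainTheorem2 {n : ℕ} (A : Matrix (Fin n) (Fin n) ℝ) (hA : A.IsSymm)
    (a b γ : ℝ) (ha : 0 ≤ a) (hab : a < b) (hγ : γ = a / b)
    (hspec : spectrum ℝ A ⊆ Set.Icc a b)
    (d : ℕ) (hd : 2 ≤ d)
    {s : ℕ} (col : Fin n → Fin s) (hcol : IsDistanceColoring (matrixGraph A hA) d col) :
    |vonNeumannEntropy A hA
        - probingTrace col (matrixFunction (fun x => -(x * Real.log x)) A hA)|
      ≤ n * b * (1 - √γ) * ((1 + γ + 2 * d * √γ) / (2 * ((d : ℝ) ^ 2 - 1)))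
          * ((1 - √γ) / (1 + √γ)) ^ d
    ∧ (a = 0 →
      |vonNeumannEntropy A hA
          - probingTrace col (matrixFunction (fun x => -(x * Real.log x)) A hA)|
        ≤ n * b / (2 * ((d : ℝ) ^ 2 - 1))) := by
  have hH := isHermitian_of_isSymm hA
  obtain ⟨t, ht0, ht⟩ := exists_probingTrace_matrixFunction_eq_sum col hA
  have hx (i) : hH.eigenvalues i ∈ Set.Icc a b := hspec (hH.eigenvalues_mem_spectrum_real i)
  have hc (p : Polynomial ℝ) (hp : p.natDegree ≤ d) :
      ∑ i, (t i - 1) * p.eval (hH.eigenvalues i) = 0 := by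
    have h1 := trace_matrixFunction hA (fun x => p.eval x)
    have h2 := ht (fun x => p.eval x)
    rw [matrixFunction_polynomial hA p] at h1 h2
    have h3 : probingTrace col (Polynomial.aeval A p) = (Polynomial.aeval A p).trace :=
      probingTrace_eq_trace fun i j hij hcij => aeval_apply_eq_zero_of_lt_edist hA hp
        (not_le.mp fun hle => hcol i j hij hle hcij)
    simp only [sub_mul, one_mul, Finset.sum_sub_distrib]
    rw [← h2, ← h1, h3, sub_self]
  have hsum : ∑ i, |t i - 1| ≤ 2 * n := by
    have h1 : ∑ i, (t i - 1) = 0 := by simpa using hc 1 (by simp)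
    -- From `t i ≥ 0`, `|t i - 1| ≤ t i + 1`; the deviations `t i - 1` sum to zero, leaving `2 n`.
    have h2 : ∑ i, |t i - 1| ≤ ∑ i, ((t i - 1) + 2) := Finset.sum_le_sum fun i _ =>
      abs_le.mpr ⟨by linarith [ht0 i], by linarith⟩
    refine h2.trans (le_of_eq ?_)
    rw [Finset.sum_add_distrib, h1]
    simp [mul_comm]
  have hd' : (2 : ℝ) ≤ d := by exact_mod_cast hd
  have hb : 0 < b := ha.trans_lt hab
  have hd3 : 0 < (d : ℝ) ^ 2 - 1 := by nlinarith
  have main : |vonNeumannEntropy A hA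
        - probingTrace col (matrixFunction (fun x => -(x * Real.log x)) A hA)|
      ≤ n * b * (1 - √γ) * ((1 + γ + 2 * d * √γ) / (2 * ((d : ℝ) ^ 2 - 1)))
          * ((1 - √γ) / (1 + √γ)) ^ d := by
    have hγ0 : 0 ≤ γ := by rw [hγ]; positivity
    have hγ1 : 0 ≤ 1 - √γ := by
      rw [sub_nonneg, Real.sqrt_le_iff, hγ, one_pow]
      exact ⟨zero_le_one, (div_le_one hb).mpr hab.le⟩
    have e : vonNeumannEntropy A hA
        - probingTrace col (matrixFunction (fun x => -(x * Real.log x)) A hA)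
        = ∑ i, (t i - 1) * (hH.eigenvalues i * Real.log (hH.eigenvalues i)) := by
      rw [ht, vonNeumannEntropy]
      simp only [sub_mul, one_mul, Finset.sum_sub_distrib, mul_neg, Finset.sum_neg_distrib]
      ring
    rw [e]
    have h := abs_sum_mul_mul_log_le hd ha hab hx hc
    rw [← hγ] at h
    refine h.trans ((mul_le_mul_of_nonneg_right hsum (by positivity)).trans (le_of_eq ?_))
    field_simp
    ring
  refine ⟨main, fun ha0 => main.trans (le_of_eq ?_)⟩
  rw [hγ, ha0]
  simp only [zero_div, Real.sqrt_zero, sub_zero, add_zero, mul_zero, mul_one, div_one, one_pow]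
  ring
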